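/- Graphs are finite, simple, undirected and vertex-coloured (a vertex labelling $l_G\colon V(G)\to C$); isomorphisms preserve adjacency, non-adjacency and colours. Weisfeiler–Leman tests (HASH is injective, $\{\!\!\{\cdot\}\!\!\}$ denotes multisets). The atomic type $\mathrm{at}_k(G,\vec v)$ of $\vec v\in V(G)^k$ records which entries are equal, which are adjacent, and the colour of each entry. $k$-WL colours $k$-tuples by $\mathrm{wl}_k^{(0)}(G,\vec v)=\mathrm{at}_k(G,\vec v)$ and $$\mathrm{wl}_k^{(t+1)}(G,\vec v)=\mathrm{HASH}\Big(\mathrm{wl}_k^{(t)}(G,\vec v),\{\!\!\{\mathrm{wl}_k^{(t)}(G,\vec v[x/1])\mid x\in V(G)\}\!\!\},\dots,\{\!\!\{\mathrm{wl}_k^{(t)}(G,\vec v[x/k])\mid x\in V(G)\}\!\!\}\Big),$$ where $\vec v[x/i]$ is $\vec v$ with the $i$-th entry replaced by $x$. $k$-MultisetWL colours multisets $\tilde v=\{\!\!\{v_1,\dots,v_k\}\!\!\}$ of $k$ vertices by letting $\mathrm{mwl}_k^{(0)}(G,\tilde v)$ be the HASH of the multiset of the atomic types of all orderings of $\tilde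 v$, and $$\mathrm{mwl}_k^{(t+1)}(G,\tilde v)=\mathrm{HASH}\Big(\mathrm{mwl}_k^{(t)}(G,\tilde v),\big\{\!\!\big\{\{\!\!\{\mathrm{mwl}_k^{(t)}(G,\tilde v[x/i])\mid x\in V(G)\}\!\!\}\mid i=1,\dots,k\big\}\!\!\big\}\Big).$$ Either test distinguishes $G$ and $G'$ if, once the iteration has stabilised (for all sufficiently large $t$), the multisets of the colours of all $k$-tuples (respectively of all $k$-multisets) of $G$ and of $G'$ differ. CFI graphs. Let $K_k$ be the complete graph on nodes $v_1,\dots,v_k$, and let $E(v)$ be the set of edges at the node $v$. For a set $T$ of nodes, $\mathcal X_T(K_k)$ has a vertex $v^X$ for every node $v$ and every $X\subseteq E(v)$ with $|X|$ odd if $v\in T$ and $|X|$ even if $v\notin T$, and two vertices $e^0,e^1$ for every edge $e$ of $K_k$. Its edges are $e^0e^1$ for every edge $e$ of $K_k$, $v^Xe^1$ for every vertex $v^X$ and $e\in X$, and $v^Xe^0$ for every vertex $v^X$ and $e\in E(v)\setminus X$. The vertices $v^X$ have colour $v$, and $e^0,e^1$ have colour $e$. **Theorem.** For every $k\ge 3$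 there is a pair of non-isomorphic graphs that $k$-MultisetWL distinguishes but $(k-1)$-WL does not. Namely, the graphs $\mathcal X_\emptyset(K_k)$ and $\mathcal X_{\{v_1\}}(K_k)$ are not isomorphic, $k$-MultisetWL distinguishes them, and $(k-1)$-WL does not distinguish them. -/

import Mathlib

universe u v w

/-- An undirected simple graph on `V` together with a labelling of the vertices by colours in `C`. -/
structure ColoredGraph (V : Type v) (C : Type u) where
  graph : SimpleGraph V
  color : V → C

namespace ColoredGraph

variable {V : Type v} {W : Type w} {C : Type u}

/-- Isomorphism of coloured graphs: a bijection of the vertices that preserves adjacency in both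
directions and preserves colours. -/
def Isomorphic (G : ColoredGraph V C) (G' : ColoredGraph W C) : Prop :=
  ∃ p : V ≃ W, (∀ x y, G.graph.Adj x y ↔ G'.graph.Adj (p x) (p y)) ∧
    ∀ x, G.color x = G'.color (p x)

/-- The coloured subgraph induced on a set of vertices. -/
def induce (G : ColoredGraph V C) (S : Set V) : ColoredGraph S C where
  graph := G.graph.induce S
  color := fun x => G.color x

end ColoredGraph

/-! ### Atomic types and the `k`-dimensional Weisfeiler-Leman test -/

/-- Values of atomic types of `k`-tuples: which entries coincide, which entries are adjacent, and
the colour of every entry. (The pairs `(i, j)` with `i ≥ j` carry no further information.) -/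
abbrev AtomicType (C : Type u) (k : ℕ) : Type u :=
  (Fin k → Fin k → Prop) × (Fin k → Fin k → Prop) × (Fin k → C)

/-- The atomic type of a `k`-tuple of vertices. -/
def atomicType {V : Type v} {C : Type u} (G : ColoredGraph V C) {k : ℕ} (x : Fin k → V) :
    AtomicType C k :=
  (fun i j => x i = x j, fun i j => G.graph.Adj (x i) (x j), fun i => G.color (x i))

/-- The colours used by `k`-WL at iteration `t`. The injective function `HASH` is the identity: a
colour is the very data that is to be hashed. It does not mention the graph, so colours of tuples
in different graphs can be compared. -/
def WLColor (C : Type u) (k : ℕ) : ℕ → Type u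
  | 0 => AtomicType C k
  | t + 1 => WLColor C k t × (Fin k → Multiset (WLColor C k t))

/-- The colour of a `k`-tuple at iteration `t` of `k`-WL. -/
def wl {V : Type v} {C : Type u} [Fintype V] (G : ColoredGraph V C) (k : ℕ) :
    (t : ℕ) → (Fin k → V) → WLColor C k t
  | 0, x => atomicType G x
  | t + 1, x =>
    (wl G k t x,
      fun i => (Finset.univ : Finset V).val.map fun y => wl G k t (Function.update x i y))

/-- The encoding of the graph at iteration `t` of `k`-WL: the multiset of the colours of all
`k`-tuples. -/
def graphWL {V : Type v} {C : Type u} [Fintype V] (G : ColoredGraph V C) (k t : ℕ) :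
    Multiset (WLColor C k t) :=
  (Finset.univ : Finset (Fin k → V)).val.map (wl G k t)

/-- `k`-WL distinguishes two graphs: their encodings differ once the iteration has stabilised,
i.e. at all sufficiently late iterations. -/
def WLDistinguishes {V : Type v} {W : Type w} {C : Type u} [Fintype V] [Fintype W] (k : ℕ)
    (G : ColoredGraph V C) (G' : ColoredGraph W C) : Prop :=
  ∀ᶠ t in Filter.atTop, graphWL G k t ≠ graphWL G' k t

/-! ### The test `k`-MultisetWL -/

/-- The colours used by `k`-MultisetWL at iteration `t`; again `HASH` is the identity. -/
def MWLColor (C : Type u) (k : ℕ) : ℕ → Type u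
  | 0 => Multiset (AtomicType C k)
  | t + 1 => MWLColor C k t × Multiset (Multiset (MWLColor C k t))

open Classical in
/-- The colour of a multiset `s` of `k` vertices at iteration `t` of `k`-MultisetWL. At iteration
`0` it is the multiset of the atomic types of all orderings of `s`, i.e. of all `k`-tuples with
underlying multiset `s`. In the step, each of the `k` elements `y` of `s`, counted with
multiplicity, is replaced by every vertex `x`: this gives one multiset of colours for each `y`, and
these multisets are collected in a multiset. (No order of the vertices is involved, as the outer
collection does not depend on the order in which the elements of `s` are listed.) -/
noncomputable def mwl {V : Type v} {C : Type u} [Fintype V] (G : ColoredGraph V C) (k : ℕ) :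
    (t : ℕ) → Multiset V → MWLColor C k t
  | 0, s =>
    ((Finset.univ : Finset (Fin k → V)).filter
      fun x => (Finset.univ : Finset (Fin k)).val.map x = s).val.map (atomicType G)
  | t + 1, s =>
    (mwl G k t s,
      s.map fun y => (Finset.univ : Finset V).val.map fun x => mwl G k t (x ::ₘ s.erase y))

open Classical in
/-- The encoding of the graph at iteration `t` of `k`-MultisetWL: the multiset of the colours of
all multisets of `k` vertices. -/
noncomputable def graphMWL {V : Type v} {C : Type u} [Fintype V] (G : ColoredGraph V C)
    (k t : ℕ) : Multiset (MWLColor C k t) :=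
  (Finset.univ : Finset (Sym V k)).val.map fun s : Sym V k => mwl G k t s.1

/-- `k`-MultisetWL distinguishes two graphs: their encodings differ once the iteration has
stabilised, i.e. at all sufficiently late iterations. -/
def MWLDistinguishes {V : Type v} {W : Type w} {C : Type u} [Fintype V] [Fintype W] (k : ℕ)
    (G : ColoredGraph V C) (G' : ColoredGraph W C) : Prop :=
  ∀ᶠ t in Filter.atTop, graphMWL G k t ≠ graphMWL G' k t

/-! ### The CFI graphs -/

section CFI

variable {U : Type u} (H : SimpleGraph U)

/-- The vertices of the enlarged graph of the base graph `H`: a vertex `v^X` for every node `v` and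
every set `X` of edges at `v`, and vertices `e^0` (`false`) and `e^1` (`true`) for every edge
`e`. -/
abbrev CFIVertex : Type u :=
  {p : U × Finset (Sym2 U) // (p.2 : Set (Sym2 U)) ⊆ H.incidenceSet p.1} ⊕ (H.edgeSet × Bool)

/-- The edges between vertices `v^X` and `e^i` of the enlarged graph: `v` is an endpoint of `e`,
and `i = 1` if `e ∈ X`, `i = 0` if `e ∉ X`. -/
def CFIJoined (p : U × Finset (Sym2 U)) (q : H.edgeSet × Bool) : Prop :=
  p.1 ∈ (q.1 : Sym2 U) ∧ (q.2 = true ↔ (q.1 : Sym2 U) ∈ p.2)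

/-- The adjacency of the enlarged graph. -/
def CFIAdj : CFIVertex H → CFIVertex H → Prop
  | .inl _, .inl _ => False
  | .inl p, .inr q => CFIJoined H p.1 q
  | .inr q, .inl p => CFIJoined H p.1 q
  | .inr q, .inr q' => q.1 = q'.1 ∧ q.2 ≠ q'.2

/-- The enlarged graph `X(H)`. The vertices `v^X` get the colour `v`, and `e^0`, `e^1` get the
colour `e`. -/
def cfiEnlarged : ColoredGraph (CFIVertex H) (U ⊕ H.edgeSet) where
  graph :=
    { Adj := CFIAdj H
      symm := ⟨by
        rintro (p | q) (p' | q') h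
        · exact h
        · exact h
        · exact h
        · exact ⟨h.1.symm, h.2.symm⟩⟩
      loopless := ⟨by
        rintro (p | q) h
        · exact h
        · exact h.2 rfl⟩ }
  color
    | .inl p => .inl p.1.1
    | .inr q => .inr q.1

/-- The vertices of `X_T(H)`: all `e^0` and `e^1`, and those `v^X` for which `|X|` is odd if
`v ∈ T` and even if `v ∉ T`. -/
def cfiVertexSet (T : Set U) : Set (CFIVertex H) :=
  {x | ∀ p, x = .inl p → (Odd p.1.2.card ↔ p.1.1 ∈ T)}

/-- The CFI graph `X_T(H)`, an induced subgraph of the enlarged graph. -/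
def cfiGraph (T : Set U) : ColoredGraph (cfiVertexSet H T) (U ⊕ H.edgeSet) :=
  (cfiEnlarged H).induce (cfiVertexSet H T)

noncomputable instance cfiFintype [Finite U] (T : Set U) : Fintype (cfiVertexSet H T) :=
  Fintype.ofFinite _

end CFI

/-! Exchanging `e^0` and `e^1` for all `e ∈ F` is an automorphism of the enlarged graph that changes
the parity at `v` by the number of edges of `F` at `v`. It carries `X_∅` to `X_{v₁}` at every node
where this number is odd exactly for `v = v₁`. By the handshake lemma some node always fails, but
adding an edge `vw` to `F` moves a defect from `v` to `w`.

With fewer than `k` pebbles the defect can always be moved to an unwatched node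
(`exists_flipsInto_of_agree`). Hence tuples related by a flip keep equal colours
(`wl_eq_of_cfiFlip`), and `(k-1)`-WL fails.

For `k`-MultisetWL take the multiset of all `v^∅`. Any choice of one `v^X` per node in `X_{v₁}`
disagrees on some edge `uv` (`exists_edge_not_agree`), so no vertex of colour `uv` is adjacent to
both ends, whereas in `X_∅` there is one. Replacing a third element by it exposes this after one
iteration: all entries have distinct colours, so forgetting their order loses nothing. The same
obstruction excludes isomorphism. -/

theorem Multiset.map_univ_val_eq_of_equiv {α β γ : Type*} [Fintype α] [Fintype β] (e : α ≃ β)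
    {f : α → γ} {g : β → γ} (h : ∀ a, f a = g (e a)) :
    (Finset.univ : Finset α).val.map f = (Finset.univ : Finset β).val.map g := by
  rw [← Finset.map_univ_equiv e, Finset.map_val, Multiset.map_map]
  exact Multiset.map_congr rfl fun a _ => h a

/-! ### Flip automorphisms -/

section Flip

variable {U : Type u} [DecidableEq U] (H : SimpleGraph U)

open Classical in
/-- The edges of `F` at the node `v`. -/
noncomputable def edgesAt (F : Finset (Sym2 U)) (v : U) : Finset (Sym2 U) :=
  F.filter (· ∈ H.incidenceSet v)

variable {H} in
theorem mem_edgesAt {F : Finset (Sym2 U)} {v : U} {e : Sym2 U} :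
    e ∈ edgesAt H F v ↔ e ∈ F ∧ e ∈ H.incidenceSet v := by
  simp [edgesAt]

open Classical in
/-- The automorphism of the enlarged graph that exchanges `e^0` and `e^1` for all edges `e ∈ F`. -/
noncomputable def cfiFlip (F : Finset (Sym2 U)) : CFIVertex H → CFIVertex H
  | .inl p => .inl ⟨(p.1.1, symmDiff p.1.2 (edgesAt H F p.1.1)), by
      intro e he
      rcases Finset.mem_symmDiff.1 he with h | h
      · exact p.2 h.1
      · exact (mem_edgesAt.1 h.1).2⟩
  | .inr q => .inr (q.1, xor q.2 (decide ((q.1 : Sym2 U) ∈ F)))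

variable {H}

theorem cfiFlip_cfiFlip (F : Finset (Sym2 U)) (x : CFIVertex H) :
    cfiFlip H F (cfiFlip H F x) = x := by
  rcases x with ⟨⟨v, X⟩, h⟩ | ⟨e, b⟩ <;> simp [cfiFlip]

theorem cfiFlip_injective (F : Finset (Sym2 U)) : Function.Injective (cfiFlip H F) :=
  Function.LeftInverse.injective (cfiFlip_cfiFlip F)

theorem color_cfiFlip (F : Finset (Sym2 U)) (x : CFIVertex H) :
    (cfiEnlarged H).color (cfiFlip H F x) = (cfiEnlarged H).color x := by
  rcases x with p | q <;> rfl

/-- The index of `e` and the membership of `e` in `X` both toggle exactly when `e ∈ F`. -/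
theorem cfiJoined_cfiFlip (F : Finset (Sym2 U))
    (p : {p : U × Finset (Sym2 U) // (p.2 : Set (Sym2 U)) ⊆ H.incidenceSet p.1})
    (q : H.edgeSet × Bool) :
    CFIAdj H (cfiFlip H F (.inl p)) (cfiFlip H F (.inr q)) ↔ CFIJoined H p.1 q := by
  obtain ⟨⟨v, X⟩, hX⟩ := p
  obtain ⟨⟨e, he⟩, b⟩ := q
  simp only [cfiFlip, CFIAdj, CFIJoined, Finset.mem_symmDiff, mem_edgesAt]
  refine and_congr_right fun hv => ?_
  have : e ∈ H.incidenceSet v := ⟨he, hv⟩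
  by_cases hF : e ∈ F <;> cases b <;> by_cases h : e ∈ X <;> simp [hF, h, this]

theorem adj_cfiFlip (F : Finset (Sym2 U)) (x y : CFIVertex H) :
    (cfiEnlarged H).graph.Adj (cfiFlip H F x) (cfiFlip H F y) ↔ (cfiEnlarged H).graph.Adj x y := by
  rcases x with p | q <;> rcases y with p' | q'
  · exact Iff.rfl
  · exact cfiJoined_cfiFlip F p q'
  · exact cfiJoined_cfiFlip F p' q
  · change (q.1 = q'.1 ∧ _) ↔ (q.1 = q'.1 ∧ _)
    refine and_congr_right fun h => ?_
    simp [h]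

/-- Flipping `F` maps the vertices of colour `c` in `X_∅(H)` to vertices of `X_T(H)`. -/
def FlipsInto (H : SimpleGraph U) (T : Set U) (F : Finset (Sym2 U)) (c : U ⊕ H.edgeSet) : Prop :=
  ∀ v, c = .inl v → (Odd (edgesAt H F v).card ↔ v ∈ T)

theorem odd_card_symmDiff {α : Type*} [DecidableEq α] (A B : Finset α) :
    Odd (symmDiff A B).card ↔ ¬ (Odd A.card ↔ Odd B.card) := by
  have h : (symmDiff A B).card + 2 * (A ∩ B).card = A.card + B.card := by
    rw [Finset.symmDiff_def, Finset.card_union_of_disjoint disjoint_sdiff_sdiff]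
    have h1 := Finset.card_sdiff_add_card_inter A B
    have h2 := Finset.card_sdiff_add_card_inter B A
    rw [Finset.inter_comm B A] at h2
    omega
  simp only [Nat.odd_iff]
  omega

theorem cfiFlip_mem {T : Set U} {F : Finset (Sym2 U)} {x : CFIVertex H}
    (hF : FlipsInto H T F ((cfiEnlarged H).color x)) (hx : x ∈ cfiVertexSet H ∅) :
    cfiFlip H F x ∈ cfiVertexSet H T := by
  rcases x with ⟨⟨v, X⟩, h⟩ | q
  · rintro p ⟨⟩
    have h1 := hx _ rfl
    have h2 := hF v rfl
    simp only [Set.mem_empty_iff_false, iff_false] at h1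
    simp only [odd_card_symmDiff]
    tauto
  · rintro p ⟨⟩

theorem cfiFlip_mem_empty {T : Set U} {F : Finset (Sym2 U)} {x : CFIVertex H}
    (hF : FlipsInto H T F ((cfiEnlarged H).color x)) (hx : x ∈ cfiVertexSet H T) :
    cfiFlip H F x ∈ cfiVertexSet H ∅ := by
  rcases x with ⟨⟨v, X⟩, h⟩ | q
  · rintro p ⟨⟩
    have h1 := hx _ rfl
    have h2 := hF v rfl
    simp only [Set.mem_empty_iff_false, iff_false, odd_card_symmDiff]
    tauto
  · rintro p ⟨⟩

/-- Converse of `cfiFlip_mem`: pebbles already matched by `F` certify that `F` has the right parity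
at their nodes. -/
theorem flipsInto_of_cfiFlip_mem {T : Set U} {F : Finset (Sym2 U)} {x : CFIVertex H}
    (hx : x ∈ cfiVertexSet H ∅) (h : cfiFlip H F x ∈ cfiVertexSet H T) :
    FlipsInto H T F ((cfiEnlarged H).color x) := by
  rcases x with ⟨⟨v, X⟩, hX⟩ | q
  · rintro _ ⟨⟩
    have h1 := hx _ rfl
    have h2 := h _ rfl
    simp only [Set.mem_empty_iff_false, iff_false] at h1
    simp only [odd_card_symmDiff] at h2
    tauto
  · rintro v ⟨⟩

/-- A bijection of the tuples of `X_∅(H)` and `X_T(H)` that flips, in a tuple `x`, the edges in a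
set that depends only on the colours of the entries of `x`. -/
noncomputable def cfiFlipEquiv {ι : Type*} {T : Set U}
    (F : (ι → U ⊕ H.edgeSet) → Finset (Sym2 U)) (hF : ∀ c i, FlipsInto H T (F c) (c i)) :
    (ι → cfiVertexSet H ∅) ≃ (ι → cfiVertexSet H T) where
  toFun x i := ⟨cfiFlip H (F fun j => (cfiEnlarged H).color (x j)) (x i),
    cfiFlip_mem (hF _ i) (x i).2⟩
  -- Flips preserve colours, so the same `F` is recovered from the image, and flips are involutions.
  invFun y i := ⟨cfiFlip H (F fun j => (cfiEnlarged H).color (y j)) (y i),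
    cfiFlip_mem_empty (hF _ i) (y i).2⟩
  left_inv x := by
    funext i
    apply Subtype.ext
    simp only [color_cfiFlip, cfiFlip_cfiFlip]
  right_inv x := by
    funext i
    apply Subtype.ext
    simp only [color_cfiFlip, cfiFlip_cfiFlip]

theorem atomicType_eq_of_cfiFlip {S T : Set U} {m : ℕ} {F : Finset (Sym2 U)}
    {x : Fin m → cfiVertexSet H S} {y : Fin m → cfiVertexSet H T}
    (h : ∀ i, (y i : CFIVertex H) = cfiFlip H F (x i)) :
    atomicType (cfiGraph H S) x = atomicType (cfiGraph H T) y := by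
  refine Prod.ext ?_ (Prod.ext ?_ ?_)
  · funext i j
    change (x i = x j) = (y i = y j)
    rw [← Subtype.coe_inj, ← Subtype.coe_inj, h, h, (cfiFlip_injective F).eq_iff]
  · funext i j
    change (cfiEnlarged H).graph.Adj (x i) (x j) = (cfiEnlarged H).graph.Adj (y i) (y j)
    rw [h, h, adj_cfiFlip]
  · funext i
    change (cfiEnlarged H).color (x i) = (cfiEnlarged H).color (y i)
    rw [h, color_cfiFlip]

end Flip

/-! ### Moving the defect in `K_k`: failure of `(k-1)`-WL -/

section CompleteGraph

variable {k : ℕ}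

theorem mem_incidenceSet_top {u v w : Fin k} (h : u ≠ v) :
    s(u, v) ∈ (⊤ : SimpleGraph (Fin k)).incidenceSet w ↔ w = u ∨ w = v := by
  simp [SimpleGraph.incidenceSet, h]

theorem odd_card_edgesAt_singleton {u v w : Fin k} (h : u ≠ v) :
    Odd (edgesAt ⊤ {s(u, v)} w).card ↔ w = u ∨ w = v := by
  rw [← mem_incidenceSet_top h, edgesAt, Finset.filter_singleton]
  split_ifs with hw <;> simp [hw]

theorem edgesAt_symmDiff {U : Type u} [DecidableEq U] (H : SimpleGraph U)
    (F F' : Finset (Sym2 U)) (v : U) :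
    edgesAt H (symmDiff F F') v = symmDiff (edgesAt H F v) (edgesAt H F' v) := by
  ext e
  simp only [mem_edgesAt, Finset.mem_symmDiff]
  tauto

/-- Fewer than `k` colours can be matched simultaneously. -/
theorem exists_flipsInto {m : ℕ} (hm : m < k) (v₁ : Fin k)
    (c : Fin m → Fin k ⊕ (⊤ : SimpleGraph (Fin k)).edgeSet) :
    ∃ F, ∀ i, FlipsInto ⊤ {v₁} F (c i) := by
  obtain ⟨u, hu⟩ : ∃ u : Fin k, ∀ i, c i ≠ .inl u := by
    by_contra! h
    choose f hf using h
    have hinj : Function.Injective f := fun a b hab => by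
      have := (hf a).symm.trans ((congrArg c hab).trans (hf b))
      exact Sum.inl_injective this
    have := Fintype.card_le_of_injective f hinj
    simp only [Fintype.card_fin] at this
    omega
  -- The defect is parked at the unwatched node `u`.
  by_cases h : v₁ = u
  · refine ⟨∅, fun i v hv => ?_⟩
    have : v ≠ v₁ := by
      rintro rfl
      exact hu i (h ▸ hv)
    simp [edgesAt, this]
  · refine ⟨{s(v₁, u)}, fun i v hv => ?_⟩
    have : v ≠ u := by
      rintro rfl
      exact hu i hv
    rw [odd_card_edgesAt_singleton h]
    simp [this]

/-- While all pebbles but the `i`-th, of fewer than `k`, stay in place, the flipped edges can be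
changed so as to match any given colour. -/
theorem exists_flipsInto_of_agree {m : ℕ} (hm : m < k) (v₁ : Fin k)
    (x : Fin m → cfiVertexSet (⊤ : SimpleGraph (Fin k)) ∅) (F : Finset (Sym2 (Fin k)))
    (hF : ∀ j, FlipsInto ⊤ {v₁} F ((cfiEnlarged ⊤).color (x j).1))
    (i : Fin m) (c : Fin k ⊕ (⊤ : SimpleGraph (Fin k)).edgeSet) :
    ∃ F', FlipsInto ⊤ {v₁} F' c ∧ ∀ j, j ≠ i → cfiFlip ⊤ F' (x j).1 = cfiFlip ⊤ F (x j).1 := by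
  by_cases hc : FlipsInto ⊤ {v₁} F c
  · exact ⟨F, hc, fun _ _ => rfl⟩
  rcases c with v | e
  swap
  · exact absurd (by rintro v ⟨⟩) hc
  have hv : ¬ (Odd (edgesAt ⊤ F v).card ↔ v ∈ ({v₁} : Set (Fin k))) := by
    intro h
    refine hc ?_
    rintro _ ⟨⟩
    exact h
  -- Each of the `m - 1 ≤ k - 2` other pebbles blocks at most one of the `k - 1` nodes `w ≠ v`, by
  -- lying on a vertex of colour `w` or on an end of the edge `vw`.
  obtain ⟨w, hwv, hw⟩ : ∃ w : Fin k, w ≠ v ∧ ∀ j, j ≠ i →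
      (∀ p, (x j).1 = .inl p → w ≠ p.1.1) ∧ (∀ q, (x j).1 = .inr q → (q.1 : Sym2 _) ≠ s(v, w)) := by
    by_contra! h
    have h' : ∀ w, w ≠ v → ∃ j, j ≠ i ∧ ((∃ p, (x j).1 = .inl p ∧ w = p.1.1) ∨
        ∃ q, (x j).1 = .inr q ∧ (q.1 : Sym2 _) = s(v, w)) := by
      intro w hw
      obtain ⟨j, hj, hj'⟩ := h w hw
      refine ⟨j, hj, ?_⟩
      by_cases hp : ∃ p, (x j).1 = .inl p ∧ w = p.1.1
      · exact .inl hp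
      · push Not at hp
        exact .inr (hj' hp)
    have : Nonempty (Fin m) := ⟨i⟩
    choose! f hf hf' using h'
    have hinj : Set.InjOn f ((Finset.univ.erase v : Finset (Fin k)) : Set (Fin k)) := by
      intro a ha b hb hab
      have ha' := hf' a (Finset.ne_of_mem_erase ha)
      have hb' := hf' b (Finset.ne_of_mem_erase hb)
      rw [← hab] at hb'
      rcases ha' with ⟨p, hp, rfl⟩ | ⟨q, hq, hqa⟩ <;> rcases hb' with ⟨p', hp', rfl⟩ | ⟨q', hq', hqb⟩
      · rw [hp] at hp'
        cases hp'
        rfl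
      · rw [hp] at hq'
        cases hq'
      · rw [hq] at hp'
        cases hp'
      · rw [hq] at hq'
        cases hq'
        exact Sym2.congr_right.1 (hqa.symm.trans hqb)
    have hle := Finset.card_le_card_of_injOn (t := Finset.univ.erase i) f
      (fun a ha => by simpa using hf a (Finset.ne_of_mem_erase ha)) hinj
    have hi := i.2
    rw [Finset.card_erase_of_mem (Finset.mem_univ _), Finset.card_erase_of_mem (Finset.mem_univ _),
      Finset.card_fin, Finset.card_fin] at hle
    omega
  refine ⟨symmDiff F {s(v, w)}, ?_, fun j hj => ?_⟩
  · rintro _ ⟨⟩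
    rw [edgesAt_symmDiff, odd_card_symmDiff, odd_card_edgesAt_singleton hwv.symm]
    tauto
  · obtain ⟨h1, h2⟩ := hw j hj
    have h3 := hF j
    rcases hx : (x j).1 with p | q
    · have hpv : p.1.1 ≠ v := by
        intro h
        rw [hx] at h3
        exact hv (h3 v (congrArg Sum.inl h))
      have hpw := h1 p hx
      have : edgesAt ⊤ {s(v, w)} p.1.1 = (∅ : Finset (Sym2 (Fin k))) := by
        rw [edgesAt, Finset.filter_singleton, if_neg]
        rw [mem_incidenceSet_top hwv.symm]
        tauto
      simp only [cfiFlip, edgesAt_symmDiff, this]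
      congr 3
      exact congrArg (symmDiff p.1.2) (symmDiff_bot (edgesAt ⊤ F p.1.1))
    · have := h2 q hx
      simp [cfiFlip, Finset.mem_symmDiff, this]

theorem wl_eq_of_cfiFlip {m : ℕ} (hm : m < k) (v₁ : Fin k) (t : ℕ) :
    ∀ (F : Finset (Sym2 (Fin k))) (x : Fin m → cfiVertexSet (⊤ : SimpleGraph (Fin k)) ∅)
      (y : Fin m → cfiVertexSet (⊤ : SimpleGraph (Fin k)) {v₁}),
      (∀ i, (y i).1 = cfiFlip ⊤ F (x i).1) →
      wl (cfiGraph ⊤ ∅) m t x = wl (cfiGraph ⊤ {v₁}) m t y := by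
  induction t with
  | zero =>
    intro F x y h
    exact atomicType_eq_of_cfiFlip h
  | succ t ih =>
    intro F x y h
    refine Prod.ext (ih F x y h) (funext fun i => ?_)
    have hF : ∀ j, FlipsInto ⊤ {v₁} F ((cfiEnlarged ⊤).color (x j).1) := fun j =>
      flipsInto_of_cfiFlip_mem (x j).2 (h j ▸ (y j).2)
    choose F' hF' hagree using exists_flipsInto_of_agree hm v₁ x F hF i
    -- `F'` depends only on the colour of the new vertex, so flipping by it is a bijection:
    -- `cfiFlipEquiv` for one-entry tuples.
    refine Multiset.map_univ_val_eq_of_equiv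
      (((Equiv.funUnique (Fin 1) _).symm.trans
        (cfiFlipEquiv (ι := Fin 1) (fun c => F' (c 0)) fun c j => ?_)).trans
          (Equiv.funUnique (Fin 1) _)) fun a => ih (F' ((cfiEnlarged ⊤).color a.1)) _ _ fun j => ?_
    · rw [Subsingleton.elim j 0]
      exact hF' _
    · by_cases hj : j = i
      · subst hj
        simp only [Function.update_self]
        rfl
      · simp only [Function.update_of_ne hj]
        rw [h, hagree _ j hj]

theorem graphWL_cfiGraph_eq {m : ℕ} (hm : m < k) (v₁ : Fin k) (t : ℕ) :
    graphWL (cfiGraph (⊤ : SimpleGraph (Fin k)) ∅) m t =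
      graphWL (cfiGraph (⊤ : SimpleGraph (Fin k)) {v₁}) m t := by
  choose F hF using exists_flipsInto (k := k) hm v₁
  exact Multiset.map_univ_val_eq_of_equiv (cfiFlipEquiv F hF) fun x =>
    wl_eq_of_cfiFlip hm v₁ t (F fun j => (cfiEnlarged ⊤).color (x j).1) x _ fun _ => rfl

/-- By the handshake lemma, edge sets `X v` at the nodes of which exactly one is odd cannot agree
on all edges. -/
theorem exists_edge_not_agree (v₁ : Fin k) (X : Fin k → Finset (Sym2 (Fin k)))
    (hX : ∀ v, (X v : Set (Sym2 (Fin k))) ⊆ (⊤ : SimpleGraph (Fin k)).incidenceSet v)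
    (hodd : ∀ v, Odd (X v).card ↔ v = v₁) :
    ∃ u v, u ≠ v ∧ ¬ (s(u, v) ∈ X u ↔ s(u, v) ∈ X v) := by
  classical
  by_contra! h
  -- If the sets agreed, they would be the edge stars of a graph whose only vertex of odd degree is
  -- `v₁`.
  let G : SimpleGraph (Fin k) :=
    { Adj := fun u v => u ≠ v ∧ s(u, v) ∈ X u
      symm := ⟨fun u v huv => ⟨huv.1.symm, by
        rw [Sym2.eq_swap]
        exact (h u v huv.1).1 huv.2⟩⟩
      loopless := ⟨fun u hu => hu.1 rfl⟩ }
  have hdeg : ∀ v, G.degree v = (X v).card := by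
    intro v
    rw [← SimpleGraph.card_incidenceFinset_eq_degree]
    congr 1
    ext e
    rw [SimpleGraph.mem_incidenceFinset]
    constructor
    · rintro ⟨he, hv⟩
      obtain ⟨w, rfl⟩ := hv
      exact he.2
    · intro he
      obtain ⟨hne, hv⟩ := hX v he
      obtain ⟨w, rfl⟩ := hv
      exact ⟨⟨by simpa using hne, he⟩, Sym2.mem_mk_left _ _⟩
  have := G.even_card_odd_degree_vertices
  simp only [hdeg, hodd] at this
  rw [Finset.filter_eq', if_pos (Finset.mem_univ _)] at this
  simp at this

/-- The vertex `v^∅` of `X_∅(K_k)`. -/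
def emptyVertex (v : Fin k) : cfiVertexSet (⊤ : SimpleGraph (Fin k)) ∅ :=
  ⟨.inl ⟨(v, ∅), by simp⟩, by rintro p ⟨⟩; simp⟩

/-- The vertex `e^0` of `X_∅(K_k)`, for `e = uv`. -/
def edgeVertex {u v : Fin k} (h : u ≠ v) : cfiVertexSet (⊤ : SimpleGraph (Fin k)) ∅ :=
  ⟨.inr (⟨s(u, v), by simpa using h⟩, false), by rintro p ⟨⟩⟩

theorem adj_emptyVertex_edgeVertex {u v w : Fin k} (h : u ≠ v) (hw : w = u ∨ w = v) :
    (cfiGraph ⊤ ∅).graph.Adj (emptyVertex w) (edgeVertex h) :=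
  ⟨by simpa using hw, by simp⟩

theorem exists_sets_of_color {v₁ : Fin k}
    {y : Fin k → cfiVertexSet (⊤ : SimpleGraph (Fin k)) {v₁}}
    (hy : ∀ v, (cfiGraph ⊤ {v₁}).color (y v) = .inl v) :
    ∃ u v, ∃ h : u ≠ v, ∀ z, (cfiGraph ⊤ {v₁}).color z = (cfiGraph ⊤ ∅).color (edgeVertex h) →
      (cfiGraph ⊤ {v₁}).graph.Adj (y u) z → ¬ (cfiGraph ⊤ {v₁}).graph.Adj (y v) z := by
  have hy' : ∀ v, ∃ X : Finset (Sym2 (Fin k)), ∃ hX, (y v).1 = .inl ⟨(v, X), hX⟩ := by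
    intro v
    have := hy v
    change (cfiEnlarged ⊤).color (y v).1 = _ at this
    rcases h : (y v).1 with ⟨⟨w, X⟩, hX⟩ | q
    · rw [h] at this
      cases this
      exact ⟨X, hX, rfl⟩
    · rw [h] at this
      cases this
  choose X hX hyX using hy'
  obtain ⟨u, v, h, hn⟩ := exists_edge_not_agree v₁ X hX fun v => (y v).2 _ (hyX v)
  refine ⟨u, v, h, ?_⟩
  rintro ⟨p | ⟨e, b⟩, hz⟩ hc hu hv
  · cases hc
  · cases hc
    change CFIAdj ⊤ (y u).1 _ at hu
    change CFIAdj ⊤ (y v).1 _ at hv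
    rw [hyX] at hu hv
    exact hn (hu.2.symm.trans hv.2)

theorem not_isomorphic_cfiGraph (v₁ : Fin k) :
    ¬ (cfiGraph (⊤ : SimpleGraph (Fin k)) ∅).Isomorphic
      (cfiGraph (⊤ : SimpleGraph (Fin k)) {v₁}) := by
  rintro ⟨p, hadj, hcol⟩
  obtain ⟨u, v, h, H⟩ := exists_sets_of_color (y := fun v => p (emptyVertex v))
    fun v => (hcol _).symm
  exact H (p (edgeVertex h)) (hcol _).symm
    ((hadj _ _).1 (adj_emptyVertex_edgeVertex h (.inl rfl)))
    ((hadj _ _).1 (adj_emptyVertex_edgeVertex h (.inr rfl)))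

/-! ### `k`-MultisetWL distinguishes after one iteration -/

theorem exists_ordering_of_mwl_zero_eq {V : Type v} {W : Type w} {C : Type u} [Fintype V]
    [Fintype W] {G : ColoredGraph V C} {G' : ColoredGraph W C} (x : Fin k → V) {s' : Multiset W}
    (h : mwl G k 0 ((Finset.univ : Finset (Fin k)).val.map x) = mwl G' k 0 s') :
    ∃ y : Fin k → W, (Finset.univ : Finset (Fin k)).val.map y = s' ∧
      atomicType G' y = atomicType G x := by
  classical
  have hx : (fun M : Multiset (AtomicType C k) => atomicType G x ∈ M)
      (mwl G k 0 ((Finset.univ : Finset (Fin k)).val.map x)) :=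
    Multiset.mem_map.2 ⟨x, Finset.mem_filter.2 ⟨Finset.mem_univ _, rfl⟩, rfl⟩
  rw [h] at hx
  obtain ⟨y, hy, hyx⟩ := Multiset.mem_map.1 hx
  exact ⟨y, (Finset.mem_filter.1 hy).2, hyx⟩

theorem cons_erase_map_univ {V : Type v} [DecidableEq V] (x : Fin k → V) (i : Fin k) (z : V) :
    z ::ₘ ((Finset.univ : Finset (Fin k)).val.map x).erase (x i) =
      (Finset.univ : Finset (Fin k)).val.map (Function.update x i z) := by
  rw [← Multiset.cons_erase (Finset.mem_univ_val i), Multiset.map_cons, Multiset.map_cons,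
    Multiset.erase_cons_head, Function.update_self]
  congr 1
  refine Multiset.map_congr rfl fun j hj => ?_
  rw [Function.update_of_ne]
  rintro rfl
  exact (Multiset.Nodup.mem_erase_iff Finset.univ.nodup).1 hj |>.1 rfl

/-- Which element of `s'` gets replaced is left open; in the application the colours determine it.
-/
theorem exists_of_mwl_succ_eq {V : Type v} {W : Type w} {C : Type u} [Fintype V] [Fintype W]
    {G : ColoredGraph V C} {G' : ColoredGraph W C} {t : ℕ} {x : Fin k → V} {s' : Multiset W}
    (h : mwl G k (t + 1) ((Finset.univ : Finset (Fin k)).val.map x) = mwl G' k (t + 1) s')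
    (i : Fin k) (z : V) :
    ∃ s'' : Multiset W, ∃ z' : W, (∀ a ∈ s'', a = z' ∨ a ∈ s') ∧
      mwl G k t ((Finset.univ : Finset (Fin k)).val.map (Function.update x i z)) =
        mwl G' k t s'' := by
  classical
  simp only [mwl] at h
  have h1 := (Prod.ext_iff.1 h).2
  have h2 := Multiset.mem_map_of_mem
    (fun y => (Finset.univ : Finset V).val.map fun a =>
      mwl G k t (a ::ₘ ((Finset.univ : Finset (Fin k)).val.map x).erase y))
    (Multiset.mem_map_of_mem x (Finset.mem_univ_val i))
  obtain ⟨y', -, h3⟩ := Multiset.mem_map.1 ((congrArg (_ ∈ ·) h1).mp h2)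
  have h4 := Multiset.mem_map_of_mem
    (fun a => mwl G k t (a ::ₘ ((Finset.univ : Finset (Fin k)).val.map x).erase (x i)))
    (Finset.mem_univ_val z)
  obtain ⟨z', -, h5⟩ := Multiset.mem_map.1 ((congrArg (_ ∈ ·) h3).mpr h4)
  rw [cons_erase_map_univ] at h5
  exact ⟨_, z', fun a ha => (Multiset.mem_cons.1 ha).imp_right Multiset.mem_of_mem_erase,
    h5.symm⟩

theorem graphMWL_one_cfiGraph_ne (hk : 3 ≤ k) (v₁ : Fin k) :
    graphMWL (cfiGraph (⊤ : SimpleGraph (Fin k)) ∅) k 1 ≠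
      graphMWL (cfiGraph (⊤ : SimpleGraph (Fin k)) {v₁}) k 1 := by
  classical
  intro heq
  have hmem : mwl (cfiGraph (⊤ : SimpleGraph (Fin k)) ∅) k 1
      ((Finset.univ : Finset (Fin k)).val.map emptyVertex) ∈
        graphMWL (cfiGraph (⊤ : SimpleGraph (Fin k)) ∅) k 1 :=
    Multiset.mem_map.2 ⟨⟨(Finset.univ : Finset (Fin k)).val.map emptyVertex, by simp⟩,
      Finset.mem_univ_val _, rfl⟩
  rw [heq] at hmem
  obtain ⟨⟨s', hs'⟩, -, hs⟩ := Multiset.mem_map.1 hmem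
  have h0 := congrArg Prod.fst hs
  obtain ⟨y, rfl, hy⟩ := exists_ordering_of_mwl_zero_eq _ h0.symm
  have hyc : ∀ v, (cfiGraph ⊤ {v₁}).color (y v) = .inl v := fun v =>
    congrFun (congrArg (fun a => a.2.2) hy) v
  obtain ⟨u, v, h, H⟩ := exists_sets_of_color hyc
  -- Here `k ≥ 3` provides an element to replace while `u` and `v` both stay.
  obtain ⟨w, hw⟩ : ∃ w, w ∉ ({u, v} : Finset (Fin k)) := by
    by_contra! hall
    have := Finset.card_le_card (fun w _ => hall w : Finset.univ ⊆ ({u, v} : Finset (Fin k)))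
    rw [Finset.card_fin] at this
    have := Finset.card_le_two (a := u) (b := v)
    omega
  simp only [Finset.mem_insert, Finset.mem_singleton, not_or] at hw
  obtain ⟨s'', z, hz, h5⟩ := exists_of_mwl_succ_eq hs.symm w (edgeVertex h)
  obtain ⟨y'', hs'', hy''⟩ := exists_ordering_of_mwl_zero_eq _ h5
  have hcol : ∀ i, (cfiGraph ⊤ {v₁}).color (y'' i) =
      (cfiGraph ⊤ ∅).color (Function.update emptyVertex w (edgeVertex h) i) := fun i =>
    congrFun (congrArg (fun a => a.2.2) hy'') i
  have hadj : ∀ i j, (cfiGraph ⊤ {v₁}).graph.Adj (y'' i) (y'' j) ↔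
      (cfiGraph ⊤ ∅).graph.Adj (Function.update emptyVertex w (edgeVertex h) i)
        (Function.update emptyVertex w (edgeVertex h) j) := fun i j =>
    iff_of_eq (congrFun (congrFun (congrArg (fun a => a.2.1) hy'') i) j)
  have hcases : ∀ i, y'' i = z ∨ ∃ j, y'' i = y j := by
    intro i
    have := Multiset.mem_map_of_mem y'' (Finset.mem_univ_val i)
    rw [hs''] at this
    refine (hz _ this).imp_right fun hmem => ?_
    obtain ⟨j, -, hj⟩ := Multiset.mem_map.1
      (show y'' i ∈ (Finset.univ : Finset (Fin k)).val.map y from hmem)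
    exact ⟨j, hj.symm⟩
  have hwcol := hcol w
  rw [Function.update_self] at hwcol
  -- The entries of `y` have node colours, so the entry with an edge colour is the new vertex.
  have hwz : y'' w = z := by
    refine (hcases w).resolve_right ?_
    rintro ⟨j, hj⟩
    rw [hj, hyc] at hwcol
    cases hwcol
  have hnode : ∀ i, i ≠ w → y'' i = y i := by
    intro i hi
    have hic := hcol i
    rw [Function.update_of_ne hi] at hic
    rcases hcases i with hz | ⟨j, hj⟩
    · rw [hz, ← hwz, hwcol] at hic
      cases hic
    · rw [hj, hyc] at hic
      cases hic
      exact hj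
  have hadj' : ∀ i, i ≠ w → (i = u ∨ i = v) → (cfiGraph ⊤ {v₁}).graph.Adj (y i) (y'' w) := by
    intro i hi hiuv
    rw [← hnode i hi, hadj, Function.update_self, Function.update_of_ne hi]
    exact adj_emptyVertex_edgeVertex h hiuv
  exact H (y'' w) hwcol (hadj' u (Ne.symm hw.1) (.inl rfl)) (hadj' v (Ne.symm hw.2) (.inr rfl))

end CompleteGraph

/-! ### Differences persist under further iterations -/

theorem map_fst_graphMWL {V : Type v} {C : Type u} [Fintype V] (G : ColoredGraph V C) (k t : ℕ) :
    Multiset.map (fun c : MWLColor C k t × Multiset (Multiset (MWLColor C k t)) => c.1)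
      (graphMWL G k (t + 1)) = graphMWL G k t :=
  Multiset.map_map _ _ _

theorem graphMWL_ne_succ {V : Type v} {W : Type w} {C : Type u} [Fintype V] [Fintype W]
    {G : ColoredGraph V C} {G' : ColoredGraph W C} {k t : ℕ}
    (h : graphMWL G k t ≠ graphMWL G' k t) : graphMWL G k (t + 1) ≠ graphMWL G' k (t + 1) :=
  fun heq => h ((map_fst_graphMWL G k t).symm.trans
    ((congrArg (Multiset.map Prod.fst) heq).trans (map_fst_graphMWL G' k t)))

theorem mwlDistinguishes_of_graphMWL_ne {V : Type v} {W : Type w} {C : Type u} [Fintype V]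
    [Fintype W] {G : ColoredGraph V C} {G' : ColoredGraph W C} {k t : ℕ}
    (h : graphMWL G k t ≠ graphMWL G' k t) : MWLDistinguishes k G G' := by
  refine Filter.eventually_atTop.2 ⟨t, fun n hn => ?_⟩
  induction n, hn using Nat.le_induction with
  | base => exact h
  | succ n _ ih => exact graphMWL_ne_succ ih

theorem theorem2 (k : ℕ) (hk : 3 ≤ k) (v₁ : Fin k) :
    ¬ (cfiGraph (⊤ : SimpleGraph (Fin k)) ∅).Isomorphic
        (cfiGraph (⊤ : SimpleGraph (Fin k)) {v₁}) ∧
    MWLDistinguishes k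
      (cfiGraph (⊤ : SimpleGraph (Fin k)) ∅) (cfiGraph (⊤ : SimpleGraph (Fin k)) {v₁}) ∧
    ¬ WLDistinguishes (k - 1)
      (cfiGraph (⊤ : SimpleGraph (Fin k)) ∅) (cfiGraph (⊤ : SimpleGraph (Fin k)) {v₁}) := by
  refine ⟨not_isomorphic_cfiGraph v₁,
    mwlDistinguishes_of_graphMWL_ne (graphMWL_one_cfiGraph_ne hk v₁), fun h => ?_⟩
  obtain ⟨t, ht⟩ := h.exists
  exact ht (graphWL_cfiGraph_eq (by omega) v₁ t)
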